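/- Let $m,n\ge 1$ be integers, let $M=\binom{m+n-1}{n}$ be the number of states of $n$ photons in $m$ modes (vectors $k\in\mathbb{N}^m$ with $k_1+\dots+k_m=n$), and let $\varphi:U(m)\to U(M)$ be the photonic homomorphism, $\varphi(S)_{l,k}=\operatorname{per}(S[l|k])/\sqrt{l_1!\cdots l_m!\,k_1!\cdots k_m!}$, where $S[l|k]$ is the $n\times n$ matrix in which row $i$ of $S$ is repeated $l_i$ times and column $j$ is repeated $k_j$ times. Let $d\varphi:\mathfrak{u}(m)\to\mathfrak{u}(M)$ be its differential at the identity. Put $\langle u,v\rangle=\tfrac12\operatorname{tr}(u^\dagger v+v^\dagger u)$, let $v_T$ be the orthogonal projection of $v\in\mathfrak{u}(M)$ to $\operatorname{im} d\varphi$ for this inner product, and let $d$ be the distance on $U(M)$ of the bi-invariant Riemannian metric that it defines, that is, the infimum of the lengths of the piecewise continuously differentiable curves in $U(M)$ joining two points. For $V\in U(M)$ let $\log V=iK$ be the principal logarithm: $K$ is Hermitian with eigenvalues in $(-\pi,\pi]$ and $\exp(iK)=V$. Let $U\in U(M)$ and $U_0\in\operatorname{im}\varphi$ (for instance $U_0=\mathrm{Id}$),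 and define $$U_{i+1}=U_i\exp\bigl((\log(U_i^{-1}U))_T\bigr),\qquad i\ge 0 .$$ Then the sequence of distances $d_i=d(U_i,U)$ is non-increasing and bounded below by $0$, and it converges to a real number. -/

import Mathlib

open scoped Matrix Matrix.Norms.Frobenius Nat

noncomputable section

/-! ### The photonic homomorphism -/

/-- The states of `n` photons in `m` modes: occupation numbers `k₁ + ⋯ + kₘ = n`.  The matrices in
`U(M)`, `M = (m + n - 1).choose n`, are indexed by them. -/
abbrev FockState (m n : ℕ) : Type :=
  ↥(Finset.piAntidiag (Finset.univ : Finset (Fin m)) n)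

/-- Positions in which mode `i` is repeated `q i` times. -/
abbrev Slots {m : ℕ} (q : Fin m → ℕ) : Type := (i : Fin m) × Fin (q i)

/-- The matrix of the evolution of `n` photons under the `m × m` scattering matrix `S`:
`⟨l| φ(S) |k⟩ = per S[l|k] / √(l₁! ⋯ lₘ! k₁! ⋯ kₘ!)`, where `S[l|k]` is the `n × n` matrix in which
row `i` of `S` is repeated `l i` times and column `j` is repeated `k j` times. -/
def photonicMatrix (m n : ℕ) (S : Matrix (Fin m) (Fin m) ℂ) :
    Matrix (FockState m n) (FockState m n) ℂ :=
  Matrix.of fun l k =>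
    (∑ e : Slots k.1 ≃ Slots l.1, ∏ x : Slots k.1, S (e x).1 x.1) /
      ((√(∏ i, ((l.1 i)! : ℝ)) : ℂ) * (√(∏ j, ((k.1 j)! : ℝ)) : ℂ))

theorem fockState_sum {m n : ℕ} (k : FockState m n) : ∑ i, k.1 i = n :=
  (Finset.mem_piAntidiag.1 k.2).1

theorem card_slots_equiv {m : ℕ} {α : Type} [Fintype α] [DecidableEq α] (f : α → Fin m)
    (q : Fin m → ℕ) :
    Fintype.card {g : α ≃ Slots q // ∀ a, (g a).1 = f a} =
      if (fun i => Fintype.card {a // f a = i}) = q then ∏ i, (q i)! else 0 := by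
  classical
  split_ifs with h
  · subst h
    let g₀ : α ≃ Slots (fun i => Fintype.card {a // f a = i}) :=
      (Equiv.sigmaFiberEquiv f).symm.trans (Equiv.sigmaCongrRight fun i => Fintype.equivFin _)
    have hg₀ : ∀ a, (g₀ a).1 = f a := fun a => rfl
    rw [← DomMulAct.stabilizer_card f]
    refine Fintype.card_congr ⟨fun g => ⟨g.1.trans g₀.symm, ?_⟩, fun s => ⟨s.1.trans g₀, ?_⟩, ?_, ?_⟩
    · funext a
      have h1 := hg₀ (g₀.symm (g.1 a))
      simp only [Equiv.apply_symm_apply] at h1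
      simp only [Function.comp, Equiv.trans_apply]
      rw [← h1, g.2]
    · intro a
      simp only [Equiv.trans_apply, hg₀]
      exact congrFun s.2 a
    · intro g; ext a : 2; simp
    · intro s; ext a : 2; simp
  · rw [Fintype.card_eq_zero_iff]
    refine ⟨fun g => h ?_⟩
    funext i
    have e1 : {a // f a = i} ≃ {x : Slots q // x.1 = i} :=
      g.1.subtypeEquiv fun a => by rw [g.2]
    rw [Fintype.card_congr e1, Fintype.card_congr (Equiv.sigmaSubtype i)]
    simp

theorem sum_slots_equiv {m n : ℕ} {α : Type} [Fintype α] [DecidableEq α]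
    (hα : Fintype.card α = n) (F : (α → Fin m) → ℂ) :
    ∑ q : FockState m n, (1 / (∏ i, ((q.1 i)! : ℂ))) *
      ∑ g : α ≃ Slots q.1, F (fun a => (g a).1) = ∑ f, F f := by
  classical
  have h1 : ∀ q : FockState m n, ∑ g : α ≃ Slots q.1, F (fun a => (g a).1) =
      ∑ f : α → Fin m, (if (fun i => Fintype.card {a // f a = i}) = q.1
        then (∏ i, ((q.1 i)! : ℂ)) else 0) * F f := by
    intro q
    rw [← Finset.sum_fiberwise_of_maps_to (s := Finset.univ) (t := Finset.univ)
      (g := fun g : α ≃ Slots q.1 => fun a => (g a).1) (fun _ _ => Finset.mem_univ _)]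
    refine Finset.sum_congr rfl fun f _ => ?_
    rw [Finset.sum_congr rfl (g := fun _ => F f)
      (fun g hg => by rw [(Finset.mem_filter.1 hg).2])]
    rw [Finset.sum_const, nsmul_eq_mul]
    congr 1
    have := card_slots_equiv f q.1
    rw [Fintype.card_subtype] at this
    simp only [funext_iff] at this ⊢
    rw [this]
    split_ifs <;> simp
  simp_rw [h1, Finset.mul_sum]
  rw [Finset.sum_comm]
  refine Finset.sum_congr rfl fun f _ => ?_
  have hmem : (fun i => Fintype.card {a // f a = i}) ∈
      Finset.piAntidiag (Finset.univ : Finset (Fin m)) n := by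
    rw [Finset.mem_piAntidiag]
    refine ⟨?_, fun _ _ => Finset.mem_univ _⟩
    rw [← hα, ← Fintype.card_sigma]
    exact Fintype.card_congr (Equiv.sigmaFiberEquiv f)
  rw [Finset.sum_eq_single (⟨_, hmem⟩ : FockState m n)]
  · have hne : (∏ i, ((Fintype.card {a // f a = i})! : ℂ)) ≠ 0 :=
      Finset.prod_ne_zero_iff.2 fun i _ => Nat.cast_ne_zero.2 (Nat.factorial_ne_zero _)
    simp only [if_true]
    field_simp
  · intro q _ hq
    rw [if_neg]
    · simp
    · intro h
      exact hq (Subtype.ext h.symm)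
  · simp

theorem sqrt_factorial_mul_self {m : ℕ} (q : Fin m → ℕ) :
    (√(∏ i, ((q i)! : ℝ)) : ℂ) * (√(∏ i, ((q i)! : ℝ)) : ℂ) = ∏ i, ((q i)! : ℂ) := by
  rw [← Complex.ofReal_mul, Real.mul_self_sqrt (Finset.prod_nonneg fun _ _ => by positivity)]
  push_cast
  rfl

theorem sqrt_factorial_ne_zero {m : ℕ} (q : Fin m → ℕ) :
    (√(∏ i, ((q i)! : ℝ)) : ℂ) ≠ 0 := by
  rw [Complex.ofReal_ne_zero]
  exact (Real.sqrt_pos.2 (Finset.prod_pos fun _ _ => by positivity)).ne'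

theorem photonicMatrix_mul {m n : ℕ} (S T : Matrix (Fin m) (Fin m) ℂ) :
    photonicMatrix m n (S * T) = photonicMatrix m n S * photonicMatrix m n T := by
  classical
  ext l k
  have hcard : Fintype.card (Slots k.1) = n := by
    simpa using fockState_sum k
  have hl := sqrt_factorial_ne_zero l.1
  have hk := sqrt_factorial_ne_zero k.1
  rw [Matrix.mul_apply]
  simp only [photonicMatrix, Matrix.of_apply]
  rw [div_eq_iff (mul_ne_zero hl hk), Finset.sum_mul]
  have h1 : ∀ q : FockState m n,
      (∑ e : Slots q.1 ≃ Slots l.1, ∏ x, S (e x).1 x.1) /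
        ((√(∏ i, ((l.1 i)! : ℝ)) : ℂ) * (√(∏ j, ((q.1 j)! : ℝ)) : ℂ)) *
      ((∑ e : Slots k.1 ≃ Slots q.1, ∏ x, T (e x).1 x.1) /
        ((√(∏ i, ((q.1 i)! : ℝ)) : ℂ) * (√(∏ j, ((k.1 j)! : ℝ)) : ℂ))) *
      ((√(∏ i, ((l.1 i)! : ℝ)) : ℂ) * (√(∏ j, ((k.1 j)! : ℝ)) : ℂ)) =
      ∑ e : Slots k.1 ≃ Slots l.1, (1 / (∏ i, ((q.1 i)! : ℂ))) *
        ∑ g : Slots k.1 ≃ Slots q.1, ∏ x, S (e x).1 (g x).1 * T (g x).1 x.1 := by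
    intro q
    have hq := sqrt_factorial_ne_zero q.1
    rw [← Finset.mul_sum, Finset.sum_comm, ← sqrt_factorial_mul_self q.1]
    have h2 : ∀ g : Slots k.1 ≃ Slots q.1,
        ∑ e : Slots k.1 ≃ Slots l.1, ∏ x, S (e x).1 (g x).1 * T (g x).1 x.1 =
        (∑ e : Slots q.1 ≃ Slots l.1, ∏ x, S (e x).1 x.1) * ∏ x, T (g x).1 x.1 := by
      intro g
      rw [Finset.sum_mul]
      refine Fintype.sum_equiv (Equiv.equivCongr g (Equiv.refl _)) _ _ fun e => ?_
      rw [Finset.prod_mul_distrib]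
      congr 1
      refine Fintype.prod_equiv g _ _ fun x => ?_
      simp [Equiv.equivCongr]
    simp_rw [h2]
    rw [← Finset.mul_sum]
    field_simp
  simp_rw [h1]
  rw [Finset.sum_comm]
  refine Finset.sum_congr rfl fun e _ => ?_
  rw [sum_slots_equiv hcard (fun f => ∏ x, S (e x).1 (f x) * T (f x) x.1)]
  simp_rw [Matrix.mul_apply]
  rw [Finset.prod_univ_sum]
  simp

theorem photonicMatrix_one (m n : ℕ) : photonicMatrix m n 1 = 1 := by
  classical
  ext l k
  have hk := sqrt_factorial_ne_zero k.1
  simp only [photonicMatrix, Matrix.of_apply, Matrix.one_apply]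
  have h1 : ∀ e : Slots k.1 ≃ Slots l.1,
      (∏ x : Slots k.1, if (e x).1 = x.1 then (1 : ℂ) else 0) =
        if ∀ x, (e x).1 = x.1 then 1 else 0 := by
    intro e
    rw [Finset.prod_ite_zero]
    simp
  simp_rw [h1]
  rw [Finset.sum_boole, ← Fintype.card_subtype, card_slots_equiv]
  have h2 : (fun i => Fintype.card {a : Slots k.1 // a.1 = i}) = k.1 := by
    funext i
    rw [Fintype.card_congr (Equiv.sigmaSubtype i)]
    simp
  rw [h2]
  by_cases h : l = k
  · subst h
    rw [if_pos rfl, if_pos rfl, sqrt_factorial_mul_self]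
    push_cast
    refine div_self (Finset.prod_ne_zero_iff.2 fun i _ =>
      Nat.cast_ne_zero.2 (Nat.factorial_ne_zero _))
  · rw [if_neg (fun h' => h (Subtype.ext h'.symm)), if_neg h]
    simp

theorem photonicMatrix_star {m n : ℕ} (S : Matrix (Fin m) (Fin m) ℂ) :
    photonicMatrix m n (star S) = star (photonicMatrix m n S) := by
  ext l k
  simp only [photonicMatrix, Matrix.star_apply, Matrix.of_apply, star_div₀, star_mul',
    RCLike.star_def, Complex.conj_ofReal, map_sum, map_prod]
  rw [mul_comm (√(∏ i, ((l.1 i)! : ℝ)) : ℂ)]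
  congr 1
  refine Fintype.sum_equiv ⟨Equiv.symm, Equiv.symm, fun _ => rfl, fun _ => rfl⟩ _ _ fun e => ?_
  refine Fintype.prod_equiv e _ _ fun x => ?_
  simp

/-- The photonic homomorphism `φ : U(m) → U(M)`. -/
def photonicHom (m n : ℕ) :
    Matrix.unitaryGroup (Fin m) ℂ →* Matrix.unitaryGroup (FockState m n) ℂ where
  toFun S := ⟨photonicMatrix m n S.1, by
    rw [Matrix.mem_unitaryGroup_iff, ← photonicMatrix_star, ← photonicMatrix_mul,
      Matrix.mem_unitaryGroup_iff.1 S.2, photonicMatrix_one]⟩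
  map_one' := Subtype.ext (photonicMatrix_one m n)
  map_mul' S T := Subtype.ext (photonicMatrix_mul S.1 T.1)

/-! ### The unitary Lie algebra, its metric, and the differential of the homomorphism -/

/-- The Lie algebra `𝔲(M)` of skew-Hermitian matrices. -/
abbrev unitaryAlgebra (ι : Type) [Fintype ι] [DecidableEq ι] :
    Submodule ℝ (Matrix ι ι ℂ) :=
  skewAdjoint.submodule ℝ (Matrix ι ι ℂ)

theorem frobenius_norm_sq {ι : Type} [Fintype ι] (A : Matrix ι ι ℂ) :
    ‖A‖ ^ 2 = ((1 / 2 : ℂ) * (Aᴴ * A + Aᴴ * A).trace).re := by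
  rw [Matrix.frobenius_norm_def, ← Real.rpow_natCast, ← Real.rpow_mul (by positivity)]
  norm_num
  simp only [Matrix.trace, Matrix.diag, Matrix.mul_apply, Complex.re_sum, Matrix.conjTranspose_apply]
  rw [Finset.sum_comm]
  have h : ∀ i j, (star (A j i) * A j i).re = ‖A j i‖ ^ 2 := by
    intro i j
    rw [← Complex.normSq_eq_norm_sq, Complex.normSq_apply]
    simp
  simp_rw [h]
  ring

/-- The inner product `⟨u, v⟩ = ½ tr (u†v + v†u)` on matrices (the trace is real); its norm is the
Frobenius norm `‖u‖ = √(∑ |uᵢⱼ|²)`. -/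
instance matrixInnerProductSpace (ι : Type) [Fintype ι] : InnerProductSpace ℝ (Matrix ι ι ℂ) :=
  { (inferInstance : NormedSpace ℝ (Matrix ι ι ℂ)) with
    inner := fun u v => ((1 / 2 : ℂ) * (uᴴ * v + vᴴ * u).trace).re
    norm_sq_eq_re_inner := fun A => frobenius_norm_sq A
    conj_inner_symm := fun u v => by simp [add_comm]
    add_left := fun u v w => by
      simp [Matrix.add_mul, Matrix.mul_add]; ring
    smul_left := fun u v r => by
      simp; ring }
/-- The differential `dφ : 𝔲(m) → 𝔲(M)` at the identity, as a linear map into all matrices: the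
entries of `φ(S)` are polynomials in the entries of `S`, and the derivative of this polynomial map
at `1` is restricted to the tangent space `𝔲(m)` of `U(m)`. -/
def photonicDifferential (m n : ℕ) :
    unitaryAlgebra (Fin m) →ₗ[ℝ] Matrix (FockState m n) (FockState m n) ℂ :=
  (fderiv ℝ (photonicMatrix m n) 1).toLinearMap.domRestrict (unitaryAlgebra (Fin m))

theorem differentiable_photonicMatrix (m n : ℕ) : Differentiable ℝ (photonicMatrix m n) := by
  have h : ∀ i j : Fin m, Differentiable ℝ (fun S : Matrix (Fin m) (Fin m) ℂ => S i j) :=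
    fun i j => (LinearMap.toContinuousLinearMap (Matrix.entryLinearMap ℝ ℂ i j)).differentiable
  have h2 : ∀ l k, Differentiable ℝ (fun S => photonicMatrix m n S l k) := by
    intro l k
    simp only [photonicMatrix, Matrix.of_apply, div_eq_mul_inv]
    refine Differentiable.mul_const ?_ _
    refine Differentiable.fun_sum fun e _ => ?_
    classical
    exact fun S => (HasFDerivAt.finsetProd fun x _ =>
      (h (e x).1 x.1 S).hasFDerivAt).differentiableAt
  have h3 : Differentiable ℝ (fun S => (fun l k => photonicMatrix m n S l k :
      FockState m n → FockState m n → ℂ)) :=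
    differentiable_pi.2 fun l => differentiable_pi.2 fun k => h2 l k
  let L : (FockState m n → FockState m n → ℂ) →ₗ[ℝ] Matrix (FockState m n) (FockState m n) ℂ :=
    (Matrix.ofLinearEquiv ℝ).toLinearMap
  exact (LinearMap.toContinuousLinearMap L).differentiable.comp h3

/-- `dφ(A)` is the velocity at `t = 0` of the curve `φ(exp(tA))`. -/
theorem hasDerivAt_photonicMatrix_exp {m n : ℕ} (A : unitaryAlgebra (Fin m)) :
    HasDerivAt (fun t : ℝ => photonicMatrix m n (NormedSpace.exp (t • A.1)))
      (photonicDifferential m n A) 0 := by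
  have h1 := hasDerivAt_exp_smul_const (𝕂 := ℝ) A.1 (0 : ℝ)
  simp only [zero_smul, NormedSpace.exp_zero, one_mul] at h1
  have h2 := (differentiable_photonicMatrix m n
    (NormedSpace.exp ((0 : ℝ) • A.1))).hasFDerivAt.comp_hasDerivAt (0 : ℝ) h1
  have h3 : photonicDifferential m n A =
      fderiv ℝ (photonicMatrix m n) (NormedSpace.exp ((0 : ℝ) • A.1)) A.1 := by
    simp [photonicDifferential]
  rw [h3]
  exact h2

theorem photonicDifferential_mem {m n : ℕ} (A : unitaryAlgebra (Fin m)) :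
    photonicDifferential m n A ∈ unitaryAlgebra (FockState m n) := by
  have h1 := hasDerivAt_photonicMatrix_exp (n := n) A
  have h2 := h1.star
  have h3 := hasDerivAt_photonicMatrix_exp (n := n) (-A)
  have h4 : (fun t : ℝ => photonicMatrix m n (NormedSpace.exp (t • (-A).1))) =
      fun t : ℝ => star (photonicMatrix m n (NormedSpace.exp (t • A.1))) := by
    funext t
    rw [← photonicMatrix_star, NormedSpace.star_exp, star_smul]
    have hA : star A.1 = -A.1 := skewAdjoint.mem_iff.1 A.2
    rw [hA]
    simp
  rw [h4] at h3
  have h5 := h2.unique h3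
  rw [map_neg] at h5
  exact skewAdjoint.mem_iff.2 h5

/-- The image algebra `im dφ`, a real subspace of `𝔲(M)`. -/
def imageAlgebra (m n : ℕ) : Submodule ℝ (Matrix (FockState m n) (FockState m n) ℂ) :=
  LinearMap.range (photonicDifferential m n)

theorem imageAlgebra_le (m n : ℕ) : imageAlgebra m n ≤ unitaryAlgebra (FockState m n) := by
  rintro _ ⟨A, rfl⟩
  exact photonicDifferential_mem A

/-- The tangent component `v_T` of `v = v_T + v_N`: the orthogonal projection to `im dφ`. -/
def tangentPart (m n : ℕ) (v : Matrix (FockState m n) (FockState m n) ℂ) :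
    Matrix (FockState m n) (FockState m n) ℂ :=
  (imageAlgebra m n).starProjection v

theorem tangentPart_mem (m n : ℕ) (v : Matrix (FockState m n) (FockState m n) ℂ) :
    tangentPart m n v ∈ imageAlgebra m n :=
  Submodule.starProjection_apply_mem _ _

/-! ### The principal logarithm -/

/-- `v = iK` is a principal logarithm of `V`: `K` is Hermitian with eigenvalues in `(-π, π]` and
`exp (iK) = V`. -/
def IsPrincipalLog {ι : Type} [Fintype ι] [DecidableEq ι] (V v : Matrix ι ι ℂ) : Prop :=
  ∃ (K : Matrix ι ι ℂ) (hK : K.IsHermitian), v = Complex.I • K ∧ NormedSpace.exp v = V ∧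
    ∀ i, hK.eigenvalues i ∈ Set.Ioc (-Real.pi) Real.pi

section CFC

open scoped Matrix.Norms.L2Operator

theorem exists_arg_matrix {ι : Type} [Fintype ι] [DecidableEq ι] (V : Matrix ι ι ℂ)
    (hV : V ∈ Matrix.unitaryGroup ι ℂ) :
    ∃ K : Matrix ι ι ℂ, K.IsHermitian ∧ NormedSpace.exp (Complex.I • K) = V ∧
      spectrum ℝ K ⊆ Set.Ioc (-Real.pi) Real.pi := by
  have hs : ∀ z ∈ spectrum ℂ V, ‖z‖ = 1 := fun z hz => spectrum.norm_eq_one_of_unitary hV hz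
  have hn : IsStarNormal V := ⟨by
    rw [Commute, SemiconjBy, Matrix.mem_unitaryGroup_iff'.1 hV, Matrix.mem_unitaryGroup_iff.1 hV]⟩
  have hc : ∀ f : ℂ → ℂ, ContinuousOn f (spectrum ℂ V) := fun f =>
    (Matrix.finite_spectrum V).continuousOn f
  have hK : IsSelfAdjoint (cfc (fun z : ℂ => (z.arg : ℂ)) V) := IsSelfAdjoint.cfc_arg V
  refine ⟨cfc (fun z : ℂ => (z.arg : ℂ)) V, hK, ?_, ?_⟩
  · rw [← cfc_const_mul Complex.I _ V (hc _), ← CFC.exp_eq_normedSpace_exp (𝕜 := ℂ) (ha := ?_),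
      ← cfc_comp' _ _ V (by fun_prop) (hc _)]
    · conv_rhs => rw [← cfc_id' ℂ V]
      refine cfc_congr fun z hz => ?_
      rw [← Complex.exp_eq_exp_ℂ, mul_comm]
      have := Complex.norm_mul_exp_arg_mul_I z
      rwa [hs z hz, Complex.ofReal_one, one_mul] at this
    · exact cfc_predicate _ V
  · intro r hr
    have h1 : (r : ℂ) ∈ spectrum ℂ (cfc (fun z : ℂ => (z.arg : ℂ)) V) := by
      have := (spectrum.algebraMap_mem_iff ℂ).2 hr
      simpa using this
    rw [cfc_map_spectrum _ V hn (hc _)] at h1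
    obtain ⟨z, -, hz⟩ := h1
    rw [← Complex.ofReal_injective hz]
    exact Complex.arg_mem_Ioc z

end CFC

theorem exists_isPrincipalLog {ι : Type} [Fintype ι] [DecidableEq ι]
    (V : Matrix.unitaryGroup ι ℂ) : ∃ v, IsPrincipalLog V.1 v := by
  obtain ⟨K, hK, h1, h2⟩ := exists_arg_matrix V.1 V.2
  exact ⟨_, K, hK, rfl, h1, fun i => h2 (hK.eigenvalues_mem_spectrum_real i)⟩

/-- The principal logarithm `log V` of a unitary matrix `V` (there is exactly one). -/
def principalLog {ι : Type} [Fintype ι] [DecidableEq ι] (V : Matrix.unitaryGroup ι ℂ) :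
    Matrix ι ι ℂ :=
  Classical.choose (exists_isPrincipalLog V)

theorem principalLog_spec {ι : Type} [Fintype ι] [DecidableEq ι] (V : Matrix.unitaryGroup ι ℂ) :
    IsPrincipalLog V.1 (principalLog V) :=
  Classical.choose_spec (exists_isPrincipalLog V)

/-! ### The Riemannian distance on `U(M)` -/

/-- `γ : [0, 1] → U(M)` is a piecewise continuously differentiable curve from `p` to `q`: it is
continuous, and there is a finite set `s` of break points such that `γ` is `C¹` on every closed
subinterval without break points in its interior. -/
structure IsCurve {ι : Type} [Fintype ι] [DecidableEq ι] (p q : Matrix.unitaryGroup ι ℂ)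
    (γ : ℝ → Matrix ι ι ℂ) : Prop where
  source : γ 0 = p.1
  target : γ 1 = q.1
  mem_unitary : ∀ t ∈ Set.Icc (0 : ℝ) 1, γ t ∈ Matrix.unitaryGroup ι ℂ
  continuousOn : ContinuousOn γ (Set.Icc 0 1)
  piecewise : ∃ s : Finset ℝ, ∀ a b : ℝ, 0 ≤ a → a < b → b ≤ 1 →
    Disjoint (Set.Ioo a b) (s : Set ℝ) → ContDiffOn ℝ 1 γ (Set.Icc a b)

/-- The length `∫₀¹ √⟨γ'(t), γ'(t)⟩ dt` of a curve in a Euclidean space. -/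
def curveLength {E : Type} [NormedAddCommGroup E] [InnerProductSpace ℝ E] (γ : ℝ → E) : ℝ :=
  ∫ t in (0 : ℝ)..1, √(inner ℝ (deriv γ t) (deriv γ t))

/-- The distance `d(p, q)`: the infimum of the lengths of the curves in `U(M)` from `p` to `q`,
with respect to the Riemannian metric that `⟨u, v⟩ = ½ tr (u†v + v†u)` induces on `U(M)`; this metric
is bi-invariant. -/
def unitaryDist {ι : Type} [Fintype ι] [DecidableEq ι] (p q : Matrix.unitaryGroup ι ℂ) : ℝ :=
  sInf {L : ℝ | ∃ γ : ℝ → Matrix ι ι ℂ, IsCurve p q γ ∧ L = curveLength γ}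

/-! ### The iteration -/

/-- `exp (v_T)`, as a unitary matrix. -/
def expTangent (m n : ℕ) (v : Matrix (FockState m n) (FockState m n) ℂ) :
    Matrix.unitaryGroup (FockState m n) ℂ :=
  ⟨NormedSpace.exp (tangentPart m n v),
    NormedSpace.exp_mem_unitary_of_mem_skewAdjoint (imageAlgebra_le m n (tangentPart_mem m n v))⟩

/-- The approximations of `U` from the starting point `U₀`:
`Uᵢ₊₁ = Uᵢ exp ((log (Uᵢ⁻¹ U))_T)`. -/
def approximation {m n : ℕ} (U U₀ : Matrix.unitaryGroup (FockState m n) ℂ) :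
    ℕ → Matrix.unitaryGroup (FockState m n) ℂ
  | 0 => U₀
  | i + 1 => approximation U U₀ i *
      expTangent m n (principalLog ((approximation U U₀ i)⁻¹ * U))

end

/-! ### The Frobenius norm and unitary matrices -/

section Unitary

variable {ι : Type} [Fintype ι] [DecidableEq ι]

/-! Let `p` be the current approximation, `v = log (p⁻¹U)`, `w = v_T`. The next point is `p exp w`,
while `U = p exp v`, so `t ↦ p exp (w + t(v - w))` joins the two. The exponential is 1-Lipschitz on
skew-Hermitian matrices for the Frobenius norm (`norm_exp_sub_exp_le`), hence this curve has length
at most `‖v - w‖`. Since `v - w` is an orthogonal projection of `v`, this is at most `‖v‖`. If `‖v‖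
≤ d(p, U)`, then one step does not increase the distance, and a non-increasing sequence bounded
below converges.

The substance is thus `norm_principalLog_le_unitaryDist`: no curve from `p` to `q` is shorter than
`‖log (p⁻¹q)‖`. The argument avoids geodesics. Translate the curve to start at `1` and subdivide it
finely. By Hoffman–Wielandt (`hoffman_wielandt`, via Birkhoff's theorem) the eigenvalues of
consecutive points can be matched with ℓ² error at most the Frobenius chord. Lifting eigenvalues to
angles costs a factor close to `1` for short chords (`exists_angle_lift`). So a vector of phases
moves from `0` to phases of `p⁻¹q`, and its norm is at most the length up to that factor. The
principal logarithm has the smallest norm among all choices of phases, and refining the subdivision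
removes the factor. -/

theorem frobenius_norm_sq_eq_sum (A : Matrix ι ι ℂ) : ‖A‖ ^ 2 = ∑ i, ∑ j, ‖A i j‖ ^ 2 := by
  rw [Matrix.frobenius_norm_def, ← Real.rpow_natCast, ← Real.rpow_mul (by positivity)]
  norm_num

theorem frobenius_norm_unitary_mul {P : Matrix ι ι ℂ} (hP : P ∈ Matrix.unitaryGroup ι ℂ)
    (A : Matrix ι ι ℂ) : ‖P * A‖ = ‖A‖ := by
  have h : (P * A)ᴴ * (P * A) = Aᴴ * A := by
    rw [Matrix.conjTranspose_mul, Matrix.mul_assoc, ← Matrix.mul_assoc Pᴴ,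
      ← Matrix.star_eq_conjTranspose P, Matrix.mem_unitaryGroup_iff'.1 hP, Matrix.one_mul]
  rw [← sq_eq_sq₀ (norm_nonneg _) (norm_nonneg _), frobenius_norm_sq, frobenius_norm_sq, h]

theorem frobenius_norm_mul_unitary {P : Matrix ι ι ℂ} (hP : P ∈ Matrix.unitaryGroup ι ℂ)
    (A : Matrix ι ι ℂ) : ‖A * P‖ = ‖A‖ := by
  rw [← Matrix.frobenius_norm_conjTranspose (A * P), Matrix.conjTranspose_mul,
    ← Matrix.star_eq_conjTranspose P, frobenius_norm_unitary_mul (Unitary.star_mem hP),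
    Matrix.frobenius_norm_conjTranspose]

theorem sum_normSq_row_unitary {W : Matrix ι ι ℂ} (hW : W ∈ Matrix.unitaryGroup ι ℂ) (i : ι) :
    ∑ j, ‖W i j‖ ^ 2 = 1 := by
  have h := congrFun (congrFun (Matrix.mem_unitaryGroup_iff.1 hW) i) i
  rw [Matrix.mul_apply, Matrix.one_apply_eq] at h
  have h2 : ((∑ j, ‖W i j‖ ^ 2 : ℝ) : ℂ) = 1 := by
    rw [← h]
    push_cast
    refine Finset.sum_congr rfl fun j _ => ?_
    rw [Matrix.star_apply, RCLike.star_def, Complex.mul_conj']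
  exact_mod_cast h2

/-- Rows of `W` are unit vectors, and so are its columns, being the conjugated rows of the unitary
`star W`. -/
theorem normSq_unitary_mem_doublyStochastic {W : Matrix ι ι ℂ}
    (hW : W ∈ Matrix.unitaryGroup ι ℂ) :
    (Matrix.of fun i j => ‖W i j‖ ^ 2) ∈ doublyStochastic ℝ ι := by
  rw [mem_doublyStochastic_iff_sum]
  refine ⟨fun i j => by simp, fun i => sum_normSq_row_unitary hW i, fun j => ?_⟩
  have := sum_normSq_row_unitary (Unitary.star_mem hW) j
  simpa [Matrix.star_apply] using this

/-- A linear functional on doubly stochastic matrices is at least its value at some permutation. -/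
theorem exists_perm_sum_le_of_doublyStochastic {D : Matrix ι ι ℝ} (hD : D ∈ doublyStochastic ℝ ι)
    (c : ι → ι → ℝ) : ∃ σ : Equiv.Perm ι, ∑ i, c i (σ i) ≤ ∑ i, ∑ j, c i j * D i j := by
  -- Birkhoff: `D` is a convex combination of permutation matrices, so the functional at `D` is a
  -- weighted average of its values at permutations, one of which is at most the average.
  obtain ⟨w, hw0, hw1, hwD⟩ := exists_eq_sum_perm_of_mem_doublyStochastic hD
  have h : ∑ i, ∑ j, c i j * D i j = ∑ σ, w σ * ∑ i, c i (σ i) := by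
    rw [← hwD]
    simp only [Matrix.sum_apply, Matrix.smul_apply, smul_eq_mul, Finset.mul_sum]
    rw [Finset.sum_congr rfl fun i _ => Finset.sum_comm, Finset.sum_comm]
    refine Finset.sum_congr rfl fun σ _ => Finset.sum_congr rfl fun i _ => ?_
    rw [Finset.sum_eq_single (σ i)]
    · simp [Equiv.Perm.permMatrix, PEquiv.toMatrix_apply, Equiv.toPEquiv_apply]
      ring
    · intro j _ hj
      simp [Equiv.Perm.permMatrix, PEquiv.toMatrix_apply, Equiv.toPEquiv_apply, Ne.symm hj]
    · simp
  by_contra! hlt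
  have hle : ∑ σ, w σ * (∑ i, ∑ j, c i j * D i j) < ∑ σ, w σ * ∑ i, c i (σ i) := by
    refine Finset.sum_lt_sum (fun σ _ => mul_le_mul_of_nonneg_left (hlt σ).le (hw0 σ)) ?_
    have : ∃ σ ∈ Finset.univ, w σ ≠ 0 := Finset.exists_ne_zero_of_sum_ne_zero (by rw [hw1]; simp)
    obtain ⟨σ, hσ, h0⟩ := this
    exact ⟨σ, hσ, mul_lt_mul_of_pos_left (hlt σ) (lt_of_le_of_ne (hw0 σ) (Ne.symm h0))⟩
  rw [← Finset.sum_mul, hw1, one_mul] at hle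
  exact hle.ne h

/-- The Hoffman–Wielandt inequality for unitarily diagonalized matrices. -/
theorem hoffman_wielandt {P Q : Matrix ι ι ℂ} (hP : P ∈ Matrix.unitaryGroup ι ℂ)
    (hQ : Q ∈ Matrix.unitaryGroup ι ℂ) (a b : ι → ℂ) :
    ∃ σ : Equiv.Perm ι, ∑ i, ‖a i - b (σ i)‖ ^ 2 ≤
      ‖P * Matrix.diagonal a * star P - Q * Matrix.diagonal b * star Q‖ ^ 2 := by
  have hW : star P * Q ∈ Matrix.unitaryGroup ι ℂ := mul_mem (Unitary.star_mem hP) hQ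
  obtain ⟨σ, hσ⟩ := exists_perm_sum_le_of_doublyStochastic
    (normSq_unitary_mem_doublyStochastic hW) fun i j => ‖a i - b j‖ ^ 2
  refine ⟨σ, hσ.trans_eq ?_⟩
  -- With `W = star P * Q`, this unitary change of both sides preserves the norm and leaves the
  -- matrix with entries `(a i - b j) * W i j`. Its squared norm is a linear functional of the
  -- doubly stochastic matrix `|W i j|²`.
  have h1 : star P * (P * Matrix.diagonal a * star P - Q * Matrix.diagonal b * star Q) * Q =
      Matrix.diagonal a * (star P * Q) - (star P * Q) * Matrix.diagonal b := by
    have hP' := Matrix.mem_unitaryGroup_iff'.1 hP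
    have hQ' := Matrix.mem_unitaryGroup_iff'.1 hQ
    rw [mul_sub, sub_mul]
    congr 1
    · rw [← mul_assoc, ← mul_assoc, hP', one_mul, mul_assoc]
    · rw [mul_assoc, mul_assoc _ (star Q), hQ', mul_one, ← mul_assoc]
  rw [← frobenius_norm_unitary_mul (Unitary.star_mem hP), ← frobenius_norm_mul_unitary hQ, h1,
    frobenius_norm_sq_eq_sum]
  refine Finset.sum_congr rfl fun i _ => Finset.sum_congr rfl fun j _ => ?_
  rw [Matrix.of_apply, ← mul_pow, ← norm_mul, Matrix.sub_apply, Matrix.diagonal_mul,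
    Matrix.mul_diagonal]
  congr 2
  ring

/-! ### Phases of unitary matrices and minimality of the principal logarithm -/

/-- `A` is unitarily diagonalizable with eigenvalues `exp (i θⱼ)`, counted with multiplicity. -/
def HasPhases (A : Matrix ι ι ℂ) (θ : ι → ℝ) : Prop :=
  ∃ P ∈ Matrix.unitaryGroup ι ℂ,
    A = P * Matrix.diagonal (fun j => Complex.exp (Complex.I * θ j)) * star P

theorem hasPhases_one : HasPhases (1 : Matrix ι ι ℂ) 0 :=
  ⟨1, one_mem _, by simp⟩

/-- Permuting the columns of the diagonalizing matrix reorders the phases; this absorbs the matching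
permutation of Hoffman–Wielandt. -/
theorem HasPhases.comp_perm {A : Matrix ι ι ℂ} {θ : ι → ℝ} (h : HasPhases A θ)
    (σ : Equiv.Perm ι) : HasPhases A (θ ∘ σ) := by
  obtain ⟨P, hP, rfl⟩ := h
  refine ⟨P.submatrix id σ, ?_, ?_⟩
  · rw [Matrix.mem_unitaryGroup_iff, Matrix.star_eq_conjTranspose, Matrix.conjTranspose_submatrix,
      Matrix.submatrix_mul_equiv, ← Matrix.star_eq_conjTranspose, Matrix.mem_unitaryGroup_iff.1 hP]
    simp
  · have h1 : Matrix.diagonal (fun j => Complex.exp (Complex.I * (θ ∘ σ) j)) =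
        (Matrix.diagonal (fun j => Complex.exp (Complex.I * θ j))).submatrix σ σ := by
      rw [Matrix.submatrix_diagonal_equiv]
      rfl
    rw [h1, Matrix.star_eq_conjTranspose (P.submatrix id σ), Matrix.conjTranspose_submatrix,
      Matrix.submatrix_mul_equiv, Matrix.submatrix_mul_equiv]
    rfl

theorem HasPhases.congr {A : Matrix ι ι ℂ} {θ θ' : ι → ℝ} (h : HasPhases A θ)
    (hθ : ∀ j, Complex.exp (Complex.I * θ' j) = Complex.exp (Complex.I * θ j)) :
    HasPhases A θ' := by
  obtain ⟨P, hP, rfl⟩ := h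
  exact ⟨P, hP, by simp_rw [hθ]⟩

/-- Phases of two matrices can be matched, up to the Frobenius distance of the matrices. -/
theorem HasPhases.exists_perm {A B : Matrix ι ι ℂ} {θ κ : ι → ℝ} (hA : HasPhases A θ)
    (hB : HasPhases B κ) : ∃ σ : Equiv.Perm ι,
      ∑ i, ‖Complex.exp (Complex.I * θ i) - Complex.exp (Complex.I * κ (σ i))‖ ^ 2 ≤
        ‖A - B‖ ^ 2 := by
  obtain ⟨P, hP, hA⟩ := hA
  obtain ⟨Q, hQ, hB⟩ := hB
  obtain ⟨σ, hσ⟩ := hoffman_wielandt hP hQ (fun i => Complex.exp (Complex.I * θ i))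
    (fun i => Complex.exp (Complex.I * κ i))
  rw [← hA, ← hB] at hσ
  exact ⟨σ, hσ⟩

theorem Matrix.IsHermitian.hasPhases_exp {K : Matrix ι ι ℂ} (hK : K.IsHermitian) :
    HasPhases (NormedSpace.exp (Complex.I • K)) hK.eigenvalues := by
  refine ⟨hK.eigenvectorUnitary.1, hK.eigenvectorUnitary.2, ?_⟩
  have h1 := hK.spectral_theorem
  rw [Unitary.conjStarAlgAut_apply] at h1
  have hinv : (hK.eigenvectorUnitary.1)⁻¹ = star hK.eigenvectorUnitary.1 :=
    Matrix.inv_eq_right_inv (Matrix.mem_unitaryGroup_iff.1 hK.eigenvectorUnitary.2)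
  have h2 : Complex.I • K = hK.eigenvectorUnitary.1 *
      Matrix.diagonal (fun j => Complex.I * (hK.eigenvalues j : ℂ)) *
        (hK.eigenvectorUnitary.1)⁻¹ := by
    conv_lhs => rw [h1]
    rw [hinv, ← Matrix.smul_mul, ← Matrix.mul_smul, ← Matrix.diagonal_smul]
    rfl
  rw [h2, Matrix.exp_conj _ _ (IsUnit.of_mul_eq_one _
    (Matrix.mem_unitaryGroup_iff.1 hK.eigenvectorUnitary.2)), hinv, Matrix.exp_diagonal]
  congr 3
  funext j
  rw [Pi.coe_exp, Complex.exp_eq_exp_ℂ]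

theorem Matrix.IsHermitian.norm_sq_eq_sum_eigenvalues {K : Matrix ι ι ℂ} (hK : K.IsHermitian) :
    ‖K‖ ^ 2 = ∑ i, hK.eigenvalues i ^ 2 := by
  have h1 := hK.spectral_theorem
  rw [Unitary.conjStarAlgAut_apply] at h1
  conv_lhs => rw [h1]
  rw [frobenius_norm_mul_unitary (Unitary.star_mem hK.eigenvectorUnitary.2),
    frobenius_norm_unitary_mul hK.eigenvectorUnitary.2, frobenius_norm_sq_eq_sum]
  refine Finset.sum_congr rfl fun i _ => ?_
  rw [Finset.sum_eq_single i]
  · simp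
  · intro j _ hj
    simp [Matrix.diagonal_apply_ne _ (Ne.symm hj)]
  · simp

theorem exists_hasPhases (V : Matrix.unitaryGroup ι ℂ) : ∃ κ : ι → ℝ, HasPhases V.1 κ := by
  obtain ⟨K, hK, h1, h2, -⟩ := principalLog_spec V
  exact ⟨_, h2 ▸ h1 ▸ hK.hasPhases_exp⟩

theorem norm_I_smul_matrix (K : Matrix ι ι ℂ) : ‖Complex.I • K‖ = ‖K‖ := by
  rw [norm_smul, Complex.norm_I, one_mul]

/-- An angle in `(-π, π]` is the smallest one in absolute value on the same point of the circle. -/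
theorem abs_le_abs_of_exp_eq {κ θ : ℝ} (hκ : κ ∈ Set.Ioc (-Real.pi) Real.pi)
    (h : Complex.exp (Complex.I * θ) = Complex.exp (Complex.I * κ)) : |κ| ≤ |θ| := by
  obtain ⟨k, hk⟩ := Complex.exp_eq_exp_iff_exists_int.1 h
  have h1 : θ = κ + k * (2 * Real.pi) := by
    have h2 : Complex.I * (θ : ℂ) = Complex.I * ((κ + k * (2 * Real.pi) : ℝ) : ℂ) := by
      rw [hk]; push_cast; ring
    exact_mod_cast mul_left_cancel₀ Complex.I_ne_zero h2
  have hpi := Real.pi_pos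
  have hle : |κ| ≤ Real.pi := abs_le.2 ⟨hκ.1.le, hκ.2⟩
  rcases eq_or_ne k 0 with rfl | hk0
  · simp [h1]
  -- For `k ≠ 0`, `2π ≤ |θ - κ| ≤ |θ| + |κ|` and `|κ| ≤ π` give `|θ| ≥ π ≥ |κ|`.
  · have h3 : (1 : ℝ) ≤ |(k : ℝ)| := by exact_mod_cast Int.one_le_abs hk0
    have h4 : |(k : ℝ) * (2 * Real.pi)| ≤ |θ| + |κ| := by
      have : (k : ℝ) * (2 * Real.pi) = θ - κ := by rw [h1]; ring
      rw [this]
      exact abs_sub _ _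
    rw [abs_mul, abs_of_pos (by positivity : (0 : ℝ) < 2 * Real.pi)] at h4
    nlinarith

/-- The principal logarithm has the smallest Frobenius norm among all choices of phases. -/
theorem HasPhases.norm_principalLog_sq_le {V : Matrix.unitaryGroup ι ℂ} {θ : ι → ℝ}
    (h : HasPhases V.1 θ) : ‖principalLog V‖ ^ 2 ≤ ∑ i, θ i ^ 2 := by
  obtain ⟨K, hK, h1, h2, h3⟩ := principalLog_spec V
  have h4 : HasPhases V.1 hK.eigenvalues := h2 ▸ h1 ▸ hK.hasPhases_exp
  -- `V` is compared with itself: the distance is `0`, so the two families of phases agree modulo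
  -- `2π` up to a permutation.
  obtain ⟨σ, hσ⟩ := h.exists_perm h4
  rw [sub_self, norm_zero, zero_pow two_ne_zero] at hσ
  have h5 := (Finset.sum_eq_zero_iff_of_nonneg fun i _ => by positivity).1
    (le_antisymm hσ (Finset.sum_nonneg fun i _ => by positivity))
  rw [h1, norm_I_smul_matrix, hK.norm_sq_eq_sum_eigenvalues, ← Equiv.sum_comp σ]
  refine Finset.sum_le_sum fun i _ => sq_le_sq.2 (abs_le_abs_of_exp_eq (h3 _) ?_)
  simpa [sub_eq_zero] using h5 i (Finset.mem_univ i)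

/-- Angles can be lifted along short chords of the unit circle, with arcs hardly longer than the
chords. -/
theorem exists_angle_lift {δ : ℝ} (θ κ : ℝ)
    (h : ‖Complex.exp (Complex.I * θ) - Complex.exp (Complex.I * κ)‖ ≤ δ) :
    ∃ θ' : ℝ, Complex.exp (Complex.I * θ') = Complex.exp (Complex.I * κ) ∧
      (1 - δ ^ 2) * |θ' - θ| ≤
        ‖Complex.exp (Complex.I * θ) - Complex.exp (Complex.I * κ)‖ := by
  -- `z` is the rotation from one point to the other. The lift turns `θ` by the principal argument
  -- of `z`, and the chord is `2 |sin (arg z / 2)|`.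
  set z : ℂ := Complex.exp (Complex.I * (κ - θ : ℝ)) with hz
  have hz1 : ‖z‖ = 1 := Complex.norm_exp_I_mul_ofReal _
  have hαe : Complex.exp (Complex.I * z.arg) = z := by
    have := Complex.norm_mul_exp_arg_mul_I z
    rwa [hz1, Complex.ofReal_one, one_mul, mul_comm] at this
  have hκ : Complex.exp (Complex.I * κ) = Complex.exp (Complex.I * θ) * z := by
    rw [hz, ← Complex.exp_add]
    push_cast
    ring_nf
  have hc : ‖Complex.exp (Complex.I * θ) - Complex.exp (Complex.I * κ)‖ =
      2 * |Real.sin (z.arg / 2)| := by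
    rw [hκ, ← mul_one_sub, norm_mul, Complex.norm_exp_I_mul_ofReal, one_mul, norm_sub_rev]
    conv_lhs => rw [← hαe]
    rw [Complex.norm_exp_I_mul_ofReal_sub_one, norm_mul, Real.norm_ofNat, Real.norm_eq_abs]
  refine ⟨θ + z.arg, ?_, ?_⟩
  · rw [hκ, Complex.ofReal_add, mul_add, Complex.exp_add, hαe]
  rw [hc] at h ⊢
  rw [add_sub_cancel_left]
  have hpi : |z.arg| ≤ Real.pi := Complex.abs_arg_le_pi z
  set x := |z.arg| / 2 with hx
  have hx0 : 0 ≤ x := by positivity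
  have hxa : |z.arg / 2| = x := by rw [abs_div, abs_two]
  have hsin : |Real.sin (z.arg / 2)| = Real.sin x := by
    rw [← hxa, Real.abs_sin_eq_sin_abs_of_abs_le_pi (by rw [hxa]; linarith [Real.pi_pos])]
  -- Jordan's inequality gives `x ≤ 2 sin x ≤ δ`; the cubic lower bound for the sine then yields
  -- `sin x ≥ (1 - δ²) x`.
  have h1 : 2 / Real.pi * x ≤ Real.sin x := Real.mul_le_sin hx0 (by linarith)
  have h2 := Real.sin_ge_sub_cube hx0
  have h3 : x ≤ 2 * Real.sin x := by
    have : x / 2 ≤ 2 / Real.pi * x := by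
      rw [div_mul_eq_mul_div, div_le_div_iff₀ two_pos Real.pi_pos]
      nlinarith [Real.pi_le_four]
    linarith
  rw [hsin] at h ⊢
  have h4 : x ^ 2 ≤ δ ^ 2 := pow_le_pow_left₀ hx0 (h3.trans h) 2
  have h5 : |z.arg| = 2 * x := by rw [hx]; ring
  rw [h5]
  nlinarith [mul_le_mul_of_nonneg_left h4 hx0]

end Unitary

/-! ### Curves in the unitary group -/

section Curves

variable {ι : Type} [Fintype ι] [DecidableEq ι]

/-- The phases of a unitary matrix can be continued to those of a nearby one. -/
theorem HasPhases.exists_lift {A : Matrix ι ι ℂ} {B : Matrix.unitaryGroup ι ℂ} {δ : ℝ}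
    (hδ1 : δ ≤ 1) {θ : EuclideanSpace ℝ ι} (hA : HasPhases A θ) (hAB : ‖A - B.1‖ ≤ δ) :
    ∃ θ' : EuclideanSpace ℝ ι, HasPhases B.1 θ' ∧ (1 - δ ^ 2) * ‖θ' - θ‖ ≤ ‖A - B.1‖ := by
  obtain ⟨κ, hκ⟩ := exists_hasPhases B
  obtain ⟨σ, hσ⟩ := hA.exists_perm hκ
  have hδ0 : 0 ≤ δ := (norm_nonneg _).trans hAB
  have hδ2 : 0 ≤ 1 - δ ^ 2 := by nlinarith
  -- Each single chord is dominated by the whole Frobenius distance, so one `δ` serves all phases.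
  have hle : ∀ i, ‖Complex.exp (Complex.I * θ i) - Complex.exp (Complex.I * κ (σ i))‖ ≤ δ := by
    intro i
    refine le_trans ?_ hAB
    refine (sq_le_sq₀ (norm_nonneg _) (norm_nonneg _)).1 (le_trans ?_ hσ)
    exact Finset.single_le_sum
      (f := fun i => ‖Complex.exp (Complex.I * θ i) - Complex.exp (Complex.I * κ (σ i))‖ ^ 2)
      (fun i _ => by positivity) (Finset.mem_univ i)
  choose θ' h1 h2 using fun i => exists_angle_lift (θ i) (κ (σ i)) (hle i)
  refine ⟨WithLp.toLp 2 θ', (hκ.comp_perm σ).congr h1, ?_⟩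
  refine (sq_le_sq₀ (by positivity) (norm_nonneg _)).1 (le_trans ?_ hσ)
  rw [mul_pow, EuclideanSpace.norm_sq_eq, Finset.mul_sum]
  refine Finset.sum_le_sum fun i _ => ?_
  rw [← mul_pow]
  exact pow_le_pow_left₀ (by positivity) (h2 i) 2

/-- A path in the unitary group that starts at `1` and whose chords are bounded by the increments
of `F` ends at a matrix whose principal logarithm is bounded by the total increment of `F`. -/
theorem norm_principalLog_le_of_chord_le {V : Matrix.unitaryGroup ι ℂ} {γ : ℝ → Matrix ι ι ℂ}
    {F : ℝ → ℝ} (h0 : γ 0 = 1) (h1 : γ 1 = V.1)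
    (hmem : ∀ t ∈ Set.Icc (0 : ℝ) 1, γ t ∈ Matrix.unitaryGroup ι ℂ)
    (hcont : ContinuousOn γ (Set.Icc 0 1))
    (hF : ∀ s ∈ Set.Icc (0 : ℝ) 1, ∀ t ∈ Set.Icc (0 : ℝ) 1, s ≤ t → ‖γ s - γ t‖ ≤ F t - F s) :
    ‖principalLog V‖ ≤ F 1 - F 0 := by
  have key : ∀ δ : ℝ, 0 < δ → δ ≤ 1 → (1 - δ ^ 2) * ‖principalLog V‖ ≤ F 1 - F 0 := by
    intro δ hδ hδ1
    have hδ2 : 0 ≤ 1 - δ ^ 2 := by nlinarith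
    obtain ⟨ε, hε, huc⟩ := Metric.uniformContinuousOn_iff.1
      (isCompact_Icc.uniformContinuousOn_of_continuous hcont) δ hδ
    obtain ⟨N, hN⟩ := exists_nat_one_div_lt hε
    have hN0 : (0 : ℝ) < N + 1 := by positivity
    have hIcc : ∀ k : ℕ, k ≤ N + 1 → (k : ℝ) / (N + 1) ∈ Set.Icc (0 : ℝ) 1 := by
      intro k hk
      refine ⟨by positivity, (div_le_one hN0).2 ?_⟩
      exact_mod_cast hk
    -- The phase vector starts at `0` and is continued from node to node; the increments of `F`
    -- telescope.
    have step : ∀ k : ℕ, k ≤ N + 1 → ∃ θ : EuclideanSpace ℝ ι,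
        HasPhases (γ (k / (N + 1))) θ ∧ (1 - δ ^ 2) * ‖θ‖ ≤ F (k / (N + 1)) - F 0 := by
      intro k
      induction k with
      | zero =>
        intro _
        refine ⟨0, ?_, by simp⟩
        rw [Nat.cast_zero, zero_div, h0]
        exact hasPhases_one
      | succ k ih =>
        intro hk
        obtain ⟨θ, hθ, hle⟩ := ih (by omega)
        have hs := hIcc k (by omega)
        have ht := hIcc (k + 1) hk
        have hlt : (k : ℝ) / (N + 1) ≤ ((k + 1 : ℕ) : ℝ) / (N + 1) := by
          gcongr
          exact Nat.le_succ k
        have hd : dist ((k : ℝ) / (N + 1)) (((k + 1 : ℕ) : ℝ) / (N + 1)) < ε := by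
          rw [dist_comm, Real.dist_eq, ← sub_div]
          push_cast
          rwa [add_sub_cancel_left, abs_of_pos (by positivity)]
        have hAB := (huc _ hs _ ht hd).le
        rw [dist_eq_norm] at hAB
        obtain ⟨θ', hθ', hle'⟩ := hθ.exists_lift (B := ⟨_, hmem _ ht⟩) hδ1 hAB
        refine ⟨θ', hθ', ?_⟩
        have h3 := hF _ hs _ ht hlt
        have h4 : ‖θ'‖ ≤ ‖θ' - θ‖ + ‖θ‖ := by
          simpa using norm_add_le (θ' - θ) θ
        have h5 := mul_le_mul_of_nonneg_left h4 hδ2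
        linarith
    obtain ⟨θ, hθ, hle⟩ := step (N + 1) le_rfl
    have hone : ((N + 1 : ℕ) : ℝ) / (N + 1) = 1 := by
      push_cast
      exact div_self hN0.ne'
    rw [hone] at hle hθ
    rw [h1] at hθ
    refine le_trans (mul_le_mul_of_nonneg_left ?_ hδ2) hle
    refine (sq_le_sq₀ (norm_nonneg _) (norm_nonneg _)).1 (hθ.norm_principalLog_sq_le.trans_eq ?_)
    rw [EuclideanSpace.norm_sq_eq]
    simp
  -- Let `δ → 0⁺` in `key`.
  have hlim : Filter.Tendsto (fun δ : ℝ => (1 - δ ^ 2) * ‖principalLog V‖)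
      (nhdsWithin 0 (Set.Ioi 0)) (nhds ((1 - (0 : ℝ) ^ 2) * ‖principalLog V‖)) :=
    (Continuous.tendsto (by fun_prop) 0).mono_left nhdsWithin_le_nhds
  have hev : ∀ᶠ δ : ℝ in nhdsWithin 0 (Set.Ioi 0),
      (1 - δ ^ 2) * ‖principalLog V‖ ≤ F 1 - F 0 := by
    filter_upwards [Ioc_mem_nhdsGT (zero_lt_one' ℝ)] with δ hδ using key δ hδ.1 hδ.2
  simpa using le_of_tendsto hlim hev

theorem curveLength_eq {E : Type} [NormedAddCommGroup E] [InnerProductSpace ℝ E] (γ : ℝ → E) :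
    curveLength γ = ∫ t in (0 : ℝ)..1, ‖deriv γ t‖ := by
  simp only [curveLength, real_inner_self_eq_norm_sq, Real.sqrt_sq (norm_nonneg _)]

theorem curveLength_nonneg {E : Type} [NormedAddCommGroup E] [InnerProductSpace ℝ E]
    (γ : ℝ → E) : 0 ≤ curveLength γ :=
  intervalIntegral.integral_nonneg zero_le_one fun _ _ => Real.sqrt_nonneg _

end Curves

/-! ### Piecewise `C¹` curves: integrable speed, chords and arcs -/

section Length

variable {E : Type} [NormedAddCommGroup E] [NormedSpace ℝ E]

/-- The derivative of a `C¹` function on a closed interval is integrable on it. -/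
theorem ContDiffOn.intervalIntegrable_deriv {γ : ℝ → E} {a b : ℝ} (hab : a < b)
    (h : ContDiffOn ℝ 1 γ (Set.Icc a b)) :
    IntervalIntegrable (deriv γ) MeasureTheory.volume a b := by
  have h1 : ContinuousOn (derivWithin γ (Set.Icc a b)) (Set.uIcc a b) := by
    rw [Set.uIcc_of_le hab.le]
    exact h.continuousOn_derivWithin (uniqueDiffOn_Icc hab) le_rfl
  -- At the endpoints `deriv γ` depends on `γ` outside the interval, so it is compared with
  -- `derivWithin` only in the interior.
  refine h1.intervalIntegrable.congr_uIoo fun t ht => ?_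
  rw [Set.uIoo_of_le hab.le] at ht
  exact derivWithin_of_mem_nhds (Icc_mem_nhds ht.1 ht.2)

/-- A finite set of reals leaves out a punctured neighbourhood of every point. -/
theorem Finset.exists_Ioo_disjoint (s : Finset ℝ) (t : ℝ) : ∃ ε > 0,
    Disjoint (Set.Ioo (t - ε) t) (s : Set ℝ) ∧ Disjoint (Set.Ioo t (t + ε)) (s : Set ℝ) := by
  have h : ((s.erase t : Finset ℝ) : Set ℝ)ᶜ ∈ nhds t :=
    (s.erase t).finite_toSet.isClosed.isOpen_compl.mem_nhds (by simp)
  obtain ⟨ε, hε, hsub⟩ := Metric.mem_nhds_iff.1 h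
  have hmem : ∀ x ∈ s, x ≠ t → ¬ |x - t| < ε := fun x hx hxt hlt =>
    hsub (show x ∈ Metric.ball t ε from hlt) (by simp [hx, hxt])
  refine ⟨ε, hε, Set.disjoint_left.2 fun x hx hxs => ?_, Set.disjoint_left.2 fun x hx hxs => ?_⟩
  · exact hmem x hxs hx.2.ne (abs_lt.2 ⟨by linarith [hx.1], by linarith [hx.2]⟩)
  · exact hmem x hxs hx.1.ne' (abs_lt.2 ⟨by linarith [hx.1], by linarith [hx.2]⟩)

/-- The derivative of a piecewise `C¹` function is integrable. -/
theorem intervalIntegrable_deriv_of_piecewise {γ : ℝ → E} {s : Finset ℝ}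
    (h : ∀ a b : ℝ, 0 ≤ a → a < b → b ≤ 1 →
      Disjoint (Set.Ioo a b) (s : Set ℝ) → ContDiffOn ℝ 1 γ (Set.Icc a b)) :
    IntervalIntegrable (deriv γ) MeasureTheory.volume 0 1 := by
  have hI : ∀ a b : ℝ, 0 ≤ a → b ≤ 1 → Disjoint (Set.Ioo a b) (s : Set ℝ) →
      MeasureTheory.IntegrableOn (deriv γ) (Set.Icc a b) := by
    intro a b ha hb hd
    rcases lt_or_ge a b with hab | hab
    · exact (intervalIntegrable_iff_integrableOn_Icc_of_le hab.le).1
        (ContDiffOn.intervalIntegrable_deriv hab (h a b ha hab hb hd))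
    -- Degenerate intervals do occur: one side of `t` collapses to a point at `t = 0` and `t = 1`.
    · exact MeasureTheory.IntegrableOn.of_measure_zero (by simp [hab])
  rw [intervalIntegrable_iff_integrableOn_Icc_of_le zero_le_one]
  refine (MeasureTheory.LocallyIntegrableOn.integrableOn_isCompact (fun t ht => ?_) isCompact_Icc)
  obtain ⟨ε, hε, hl, hr⟩ := s.exists_Ioo_disjoint t
  refine ⟨Set.Icc (max 0 (t - ε)) t ∪ Set.Icc t (min 1 (t + ε)), ?_, ?_⟩
  · refine mem_nhdsWithin_iff_exists_mem_nhds_inter.2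
      ⟨Set.Icc (t - ε) (t + ε), Icc_mem_nhds (by linarith) (by linarith), ?_⟩
    rintro x ⟨⟨h1, h2⟩, h3, h4⟩
    rcases le_total x t with hx | hx
    · exact Or.inl ⟨max_le h3 h1, hx⟩
    · exact Or.inr ⟨hx, le_min h4 h2⟩
  · refine (hI _ _ (le_max_left _ _) ht.2 (hl.mono_left ?_)).union
      (hI _ _ ht.1 (min_le_left _ _) (hr.mono_left ?_))
    · exact Set.Ioo_subset_Ioo_left (le_max_right _ _)
    · exact Set.Ioo_subset_Ioo_right (min_le_right _ _)

/-- The chords of a piecewise `C¹` curve are bounded by the lengths of its arcs. -/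
theorem norm_sub_le_integral_norm_deriv [CompleteSpace E] {γ : ℝ → E} {s : Finset ℝ}
    (hcont : ContinuousOn γ (Set.Icc 0 1))
    (h : ∀ a b : ℝ, 0 ≤ a → a < b → b ≤ 1 →
      Disjoint (Set.Ioo a b) (s : Set ℝ) → ContDiffOn ℝ 1 γ (Set.Icc a b))
    {a b : ℝ} (ha : 0 ≤ a) (hab : a ≤ b) (hb : b ≤ 1) :
    ‖γ b - γ a‖ ≤ ∫ t in a..b, ‖deriv γ t‖ := by
  have hint : IntervalIntegrable (deriv γ) MeasureTheory.volume a b :=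
    (intervalIntegrable_deriv_of_piecewise h).mono_set (by
      rw [Set.uIcc_of_le hab, Set.uIcc_of_le zero_le_one]
      exact Set.Icc_subset_Icc ha hb)
  -- The fundamental theorem of calculus tolerates the break points: continuity there and
  -- differentiability off a countable set suffice.
  rw [← MeasureTheory.integral_eq_of_hasDerivAt_off_countable_of_le γ (deriv γ) hab
    s.countable_toSet (hcont.mono (Set.Icc_subset_Icc ha hb)) (fun t ht => ?_) hint]
  · exact intervalIntegral.norm_integral_le_integral_norm hab
  · obtain ⟨ε, hε, hl, hr⟩ := s.exists_Ioo_disjoint t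
    have hts : t ∉ s := ht.2
    have hlt1 : max 0 (t - ε) < t := max_lt (ha.trans_lt ht.1.1) (by linarith)
    have hlt2 : t < min 1 (t + ε) := lt_min (ht.1.2.trans_le hb) (by linarith)
    have hd : Disjoint (Set.Ioo (max 0 (t - ε)) (min 1 (t + ε))) (s : Set ℝ) := by
      refine Set.disjoint_left.2 fun x hx hxs => ?_
      rcases lt_trichotomy x t with hxt | rfl | hxt
      · exact Set.disjoint_left.1 hl ⟨(le_max_right _ _).trans_lt hx.1, hxt⟩ hxs
      · exact hts hxs
      · exact Set.disjoint_left.1 hr ⟨hxt, hx.2.trans_le (min_le_right _ _)⟩ hxs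
    exact (((h _ _ (le_max_left _ _) (hlt1.trans hlt2) (min_le_left _ _) hd).differentiableOn
      one_ne_zero).differentiableAt (Icc_mem_nhds hlt1 hlt2)).hasDerivAt

end Length

/-! ### The Riemannian distance and the principal logarithm -/

section Distance

variable {ι : Type} [Fintype ι] [DecidableEq ι]

theorem IsCurve.norm_principalLog_le {p q : Matrix.unitaryGroup ι ℂ} {γ : ℝ → Matrix ι ι ℂ}
    (h : IsCurve p q γ) : ‖principalLog (p⁻¹ * q)‖ ≤ curveLength γ := by
  obtain ⟨s, hs⟩ := h.piecewise
  have hint := (intervalIntegrable_deriv_of_piecewise hs).norm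
  have hp : star p.1 ∈ Matrix.unitaryGroup ι ℂ := Unitary.star_mem p.2
  -- Left translation by `p⁻¹` makes the curve start at `1` without changing chords; `F` is the arc
  -- length.
  have key := norm_principalLog_le_of_chord_le (V := p⁻¹ * q) (γ := fun t => star p.1 * γ t)
    (F := fun t => ∫ u in (0 : ℝ)..t, ‖deriv γ u‖) ?_ ?_ (fun t ht => mul_mem hp (h.mem_unitary t ht))
    (h.continuousOn.const_mul _) ?_
  · refine key.trans_eq ?_
    rw [intervalIntegral.integral_same, sub_zero]
    exact (curveLength_eq γ).symm
  · simp [h.source, Matrix.mem_unitaryGroup_iff'.1 p.2]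
  · simp [h.target]
  · intro a ha b hb hab
    have hsub : ∀ c ∈ Set.Icc (0 : ℝ) 1,
        IntervalIntegrable (fun u => ‖deriv γ u‖) MeasureTheory.volume 0 c := fun c hc =>
      hint.mono_set (by
        rw [Set.uIcc_of_le hc.1, Set.uIcc_of_le zero_le_one]
        exact Set.Icc_subset_Icc_right hc.2)
    rw [intervalIntegral.integral_interval_sub_left (hsub b hb) (hsub a ha), ← mul_sub,
      frobenius_norm_unitary_mul hp, norm_sub_rev]
    exact norm_sub_le_integral_norm_deriv h.continuousOn hs ha.1 hab hb.2

/-- The exponential map does not increase distances between skew-Hermitian matrices. -/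
theorem norm_exp_sub_exp_le {X Y : Matrix ι ι ℂ} (hX : X ∈ unitaryAlgebra ι)
    (hY : Y ∈ unitaryAlgebra ι) : ‖NormedSpace.exp X - NormedSpace.exp Y‖ ≤ ‖X - Y‖ := by
  have hexp : ∀ (Z : Matrix ι ι ℂ) (s : ℝ), Z ∈ unitaryAlgebra ι →
      NormedSpace.exp (s • Z) ∈ Matrix.unitaryGroup ι ℂ := fun Z s hZ =>
    NormedSpace.exp_mem_unitary_of_mem_skewAdjoint ((unitaryAlgebra ι).smul_mem s hZ)
  -- This path runs from `exp Y` to `exp X`, and its velocity is `X - Y` between two unitary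
  -- factors, hence of constant norm `‖X - Y‖`.
  have hd : ∀ s : ℝ, HasDerivAt
      (fun s : ℝ => NormedSpace.exp (s • X) * NormedSpace.exp ((1 - s) • Y))
      (NormedSpace.exp (s • X) * (X - Y) * NormedSpace.exp ((1 - s) • Y)) s := by
    intro s
    have h1 := hasDerivAt_exp_smul_const (𝕂 := ℝ) X s
    have h2 := (hasDerivAt_exp_smul_const' (𝕂 := ℝ) Y (1 - s)).scomp s
      ((hasDerivAt_id s).const_sub 1)
    have h3 : NormedSpace.exp (s • X) * (X - Y) * NormedSpace.exp ((1 - s) • Y) =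
        NormedSpace.exp (s • X) * X * NormedSpace.exp ((1 - s) • Y) +
          NormedSpace.exp (s • X) * (-1 : ℝ) • (Y * NormedSpace.exp ((1 - s) • Y)) := by
      rw [neg_smul, one_smul, mul_neg, mul_sub, sub_mul, ← sub_eq_add_neg, mul_assoc _ Y]
    rw [h3]
    exact h1.mul h2
  have h := norm_image_sub_le_of_norm_deriv_le_segment_01' (C := ‖X - Y‖)
    (fun s _ => (hd s).hasDerivWithinAt) (fun s _ => by
      rw [frobenius_norm_mul_unitary (hexp Y _ hY), frobenius_norm_unitary_mul (hexp X _ hX)])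
  simpa using h

theorem unitaryDist_le_curveLength {p q : Matrix.unitaryGroup ι ℂ} {γ : ℝ → Matrix ι ι ℂ}
    (h : IsCurve p q γ) : unitaryDist p q ≤ curveLength γ :=
  csInf_le ⟨0, by rintro _ ⟨γ, -, rfl⟩; exact curveLength_nonneg γ⟩ ⟨γ, h, rfl⟩

theorem unitaryDist_nonneg (p q : Matrix.unitaryGroup ι ℂ) : 0 ≤ unitaryDist p q :=
  Real.sInf_nonneg (by rintro _ ⟨γ, -, rfl⟩; exact curveLength_nonneg γ)

theorem contDiff_exp_matrix : ContDiff ℝ 1 (NormedSpace.exp : Matrix ι ι ℂ → Matrix ι ι ℂ) :=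
  contDiff_iff_contDiffAt.2 fun x => (NormedSpace.exp_analytic (𝕂 := ℝ) x).contDiffAt

/-- The image under `p * exp` of the segment between two skew-Hermitian matrices. -/
theorem isCurve_mul_exp_segment {p q r : Matrix.unitaryGroup ι ℂ} {w v : Matrix ι ι ℂ}
    (hw : w ∈ unitaryAlgebra ι) (hv : v ∈ unitaryAlgebra ι)
    (hq : q.1 = p.1 * NormedSpace.exp w) (hr : r.1 = p.1 * NormedSpace.exp v) :
    IsCurve q r fun t => p.1 * NormedSpace.exp (w + t • (v - w)) := by
  have hc : ContDiff ℝ 1 fun t : ℝ => p.1 * NormedSpace.exp (w + t • (v - w)) :=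
    contDiff_const.mul (contDiff_exp_matrix.comp
      (contDiff_const.add (contDiff_id.smul contDiff_const)))
  exact {
    source := by simp [hq]
    target := by simp [hr]
    mem_unitary := fun t _ => mul_mem p.2 (NormedSpace.exp_mem_unitary_of_mem_skewAdjoint
      ((unitaryAlgebra ι).add_mem hw ((unitaryAlgebra ι).smul_mem t
        ((unitaryAlgebra ι).sub_mem hv hw))))
    continuousOn := hc.continuous.continuousOn
    piecewise := ⟨∅, fun _ _ _ _ _ _ => hc.contDiffOn⟩ }

/-- The Lipschitz bound for `exp` bounds the speed pointwise, so no formula for the derivative of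
`exp` along a segment is needed. -/
theorem curveLength_mul_exp_segment_le (p : Matrix.unitaryGroup ι ℂ) {w v : Matrix ι ι ℂ}
    (hw : w ∈ unitaryAlgebra ι) (hv : v ∈ unitaryAlgebra ι) :
    curveLength (fun t : ℝ => p.1 * NormedSpace.exp (w + t • (v - w))) ≤ ‖v - w‖ := by
  have hmem : ∀ t : ℝ, w + t • (v - w) ∈ unitaryAlgebra ι := fun t =>
    (unitaryAlgebra ι).add_mem hw ((unitaryAlgebra ι).smul_mem t
      ((unitaryAlgebra ι).sub_mem hv hw))
  have hlip : ∀ t : ℝ,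
      ‖deriv (fun t : ℝ => p.1 * NormedSpace.exp (w + t • (v - w))) t‖ ≤ ‖v - w‖ := by
    intro t
    refine norm_deriv_le_of_lip' (norm_nonneg _) (Filter.Eventually.of_forall fun u => ?_)
    rw [← mul_sub, frobenius_norm_unitary_mul p.2]
    refine (norm_exp_sub_exp_le (hmem u) (hmem t)).trans_eq ?_
    rw [add_sub_add_left_eq_sub, ← sub_smul, norm_smul, mul_comm]
  rw [curveLength_eq]
  have h := intervalIntegral.norm_integral_le_of_norm_le_const
    (f := fun t => ‖deriv (fun t : ℝ => p.1 * NormedSpace.exp (w + t • (v - w))) t‖)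
    (a := 0) (b := 1) (C := ‖v - w‖) fun t _ => by rw [norm_norm]; exact hlip t
  rw [sub_zero, abs_one, mul_one] at h
  exact (le_abs_self _).trans h

theorem principalLog_mem (V : Matrix.unitaryGroup ι ℂ) : principalLog V ∈ unitaryAlgebra ι := by
  obtain ⟨K, hK, h1, -⟩ := principalLog_spec V
  refine skewAdjoint.mem_iff.2 ?_
  rw [h1, star_smul, Matrix.star_eq_conjTranspose, hK.eq]
  simp

theorem mul_exp_principalLog (p q : Matrix.unitaryGroup ι ℂ) :
    q.1 = p.1 * NormedSpace.exp (principalLog (p⁻¹ * q)) := by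
  obtain ⟨K, -, -, h, -⟩ := principalLog_spec (p⁻¹ * q)
  rw [h]
  exact congrArg Subtype.val (mul_inv_cancel_left p q).symm

/-- The principal logarithm is bounded by the Riemannian distance. -/
theorem norm_principalLog_le_unitaryDist (p q : Matrix.unitaryGroup ι ℂ) :
    ‖principalLog (p⁻¹ * q)‖ ≤ unitaryDist p q := by
  -- A lower bound passes to the infimum only if some curve exists (`sInf ∅ = 0` in `ℝ`); the
  -- witness is `p exp (t v)`, the segment from `0`.
  refine le_csInf ⟨_, _, isCurve_mul_exp_segment (p := p) (unitaryAlgebra ι).zero_mem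
    (principalLog_mem (p⁻¹ * q)) (by simp) (mul_exp_principalLog p q), rfl⟩ ?_
  rintro _ ⟨γ, hγ, rfl⟩
  exact hγ.norm_principalLog_le

end Distance

/-! ### Monotonicity of the distance along the iteration -/

/-- The normal part `v - v_T` is the orthogonal projection of `v` to the complement of `im dφ`, and
projections are contractions. -/
theorem norm_sub_tangentPart_le (m n : ℕ) (v : Matrix (FockState m n) (FockState m n) ℂ) :
    ‖v - tangentPart m n v‖ ≤ ‖v‖ := by
  have h := (imageAlgebra m n)ᗮ.norm_starProjection_apply_le v
  rwa [Submodule.starProjection_orthogonal_val] at h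

/-- One step of the iteration does not increase the distance to the target. -/
theorem unitaryDist_mul_expTangent_le {m n : ℕ} (U p : Matrix.unitaryGroup (FockState m n) ℂ) :
    unitaryDist (p * expTangent m n (principalLog (p⁻¹ * U))) U ≤ unitaryDist p U := by
  have hw := imageAlgebra_le m n (tangentPart_mem m n (principalLog (p⁻¹ * U)))
  have hv := principalLog_mem (p⁻¹ * U)
  calc _ ≤ _ := unitaryDist_le_curveLength
          (isCurve_mul_exp_segment (p := p) hw hv rfl (mul_exp_principalLog p U))
    _ ≤ _ := curveLength_mul_exp_segment_le p hw hv
    _ ≤ _ := norm_sub_tangentPart_le m n _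
    _ ≤ _ := norm_principalLog_le_unitaryDist p U

theorem mainTheorem4 (m n : ℕ) (U U₀ : Matrix.unitaryGroup (FockState m n) ℂ)
    (hU₀ : U₀ ∈ (photonicHom m n).range) :
    Antitone (fun i : ℕ => unitaryDist (approximation U U₀ i) U) ∧
      (∀ i : ℕ, 0 ≤ unitaryDist (approximation U U₀ i) U) ∧
      ∃ d : ℝ, Filter.Tendsto (fun i : ℕ => unitaryDist (approximation U U₀ i) U)
        Filter.atTop (nhds d) := by
  have hanti : Antitone (fun i : ℕ => unitaryDist (approximation U U₀ i) U) :=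
    antitone_nat_of_succ_le fun i => unitaryDist_mul_expTangent_le U (approximation U U₀ i)
  have hnonneg : ∀ i : ℕ, 0 ≤ unitaryDist (approximation U U₀ i) U := fun i =>
    unitaryDist_nonneg _ _
  exact ⟨hanti, hnonneg, _, tendsto_atTop_ciInf hanti
    ⟨0, by rintro _ ⟨i, rfl⟩; exact hnonneg i⟩⟩
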